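/- **Databases.** Fix a countably infinite set $\mathbf V$ of values. A schema $\mathbf S$ is a finite set of relation symbols $R$, each with an arity $\mathrm{ar}(R)\ge 0$. A database $D$ is a finite set of facts $R(\bar v)$ with $R\in\mathbf S$ and $\bar v\in\mathbf V^{\mathrm{ar}(R)}$; $\mathrm{adom}(D)$ is the set of values that occur in its facts. A pointed database $D^u$ is a database $D$ with a distinguished $u\in\mathrm{adom}(D)$. A homomorphism $F^v\to D^u$ is a map $h:\mathrm{adom}(F)\to\mathrm{adom}(D)$ with $h(v)=u$ such that $R(\bar w)\in F$ implies $R(h(\bar w))\in D$. **Networks.** An FNN is a finite nonempty sequence of layers $\bar x\mapsto\sigma(\bar x\cdot A+\bar b)$ of matching dimensions, with a real matrix $A$, a real vector $\bar b$ and an activation function $\sigma:\mathbb R\to\mathbb R$ applied componentwise. It is called *dyadic* here if all entries of the matrices $A$ and vectors $\bar b$ are dyadic rationals and every $\sigma$ is continuous and piecewise linear with finitely many pieces, all of whose slopes, intercepts and thresholds are dyadic rationals. A homomorphism query of input dimension $d$ and output dimension $e>0$ with sum aggregation consists of a pointed database $F^\bullet$ and a transformation function $\mu_v:\mathbb R^d\to\mathbb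 R^e$ for every $v\in\mathrm{adom}(F)$; for $\lambda:\mathrm{adom}(D)\to\mathbb R^d$ and $u\in \mathrm{adom}(D)$ its result is $\sum_{h:F^\bullet\to D^u}\ \prod_{v\in\mathrm{adom}(F)}\mu_v(\lambda(h(v)))\in\mathbb R^e$ (componentwise product, $h$ ranging over homomorphisms). A layer consists of finitely many such queries of the same input dimension $d$, with output dimensions $d_1,\dots,d_m$, and a combination function $\mathbb R^{d_1}\times\dots\times\mathbb R^{d_m}\to\mathbb R^{d'}$; it maps $\lambda$ to the embedding $\mathrm{adom}(D)\to\mathbb R^{d'}$ obtained by applying the combination function to the results of the queries at each $u$. A sum-DHN $\mathcal N$ is a finite sequence of layers of matching dimensions, the first of input dimension $0$, with a classification function $\mathsf{cls}:\mathbb R^{d}\to\mathbb R$, where $d$ is the last output dimension. It accepts $D^u$ if $\mathsf{cls}(\lambda(u))=1$ and rejects $D^u$ otherwise, where $\lambda$ is obtained by applying all layers successively to the embedding that assigns the empty vector to every value. **The logic HML+C.** There are individual variables, ranging over $\mathrm{adom}(D)$, and number variables, ranging over $\mathbb N$. Terms $t(x,\bar n)$ and formulas $\varphi(x,\bar n)$,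 with at most one free individual variable $x$, are given by $$t ::= c \mid n \mid t+t \mid t\cdot t \mid \#(\bar y,\,m_1<t_1,\dots,m_k<t_k).\,\psi ,\qquad \varphi ::= \neg\varphi\mid\varphi\vee\varphi\mid t\le t',$$ where $c\in\mathbb N$, $n$ is a number variable, $\psi$ is a conjunction of relational atoms $R(\bar z)$ with all variables among $x,\bar y$ and of formulas $\chi(z,\bar n,m_1,\dots,m_k)$ with a single individual variable $z$, which is $x$ or in $\bar y$, and each bounding term $t_i$ is built with $+$ and $\cdot$ from constants, number variables among $\bar n,m_1,\dots,m_{i-1}$, and counting terms over these number variables each of which has at most one free individual variable, which is $x$ or in $\bar y$ (different ones may be used within one $t_i$). The counting term denotes the number of tuples $(\bar a,b_1,\dots,b_k)$, with $\bar a$ over $\mathrm{adom}(D)$ and $b_i\in\mathbb N$, such that $b_i$ is smaller than the value of $t_i$ at $\bar y=\bar a$, $m_1=b_1,\dots,m_{i-1}=b_{i-1}$ for every $i$, and $\psi$ holds at $\bar y=\bar a$, $\bar m=\bar b$. The rest of the semantics is the standard one. **Theorem.** Let $\mathcal N$ be a sum-DHN over a schema $\mathbf S$ such that all its transformation functions,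 combination functions and its classification function are represented by dyadic FNNs. Then there is an HML+C formula $\varphi(x)$ over $\mathbf S$, without free number variables, that is equivalent to $\mathcal N$: for every database $D$ over $\mathbf S$ and every $u\in\mathrm{adom}(D)$, $\mathcal N$ accepts $D^u$ if and only if $D\models\varphi(u)$. -/

import Mathlib

noncomputable section

namespace DHNLogic

/-! ### Schemas, databases, homomorphisms -/

/-- A schema: finitely many relation symbols, each with an arity (possibly `0`). -/
structure Schema where
  Rel : Type
  finite_rel : Finite Rel
  ar : Rel → ℕ

/-- A fact `R(v₁, …, vₖ)` over the schema `S` with values from `V`. -/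
abbrev Fact (S : Schema) (V : Type*) := Σ R : S.Rel, (Fin (S.ar R) → V)

/-- A database: a finite set of facts. -/
structure Database (S : Schema) (V : Type*) where
  facts : Finset (Fact S V)

/-- The active domain: the values that occur in some fact. -/
def Database.adom {S : Schema} {V : Type*} (D : Database S V) : Set V :=
  {v | ∃ f ∈ D.facts, ∃ i, f.2 i = v}

theorem Database.adom_finite {S : Schema} {V : Type*} (D : Database S V) :
    D.adom.Finite := by
  have h : D.adom = ⋃ f ∈ (D.facts : Set (Fact S V)), Set.range f.2 := by
    ext v
    simp [Database.adom]
  rw [h]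
  exact Set.Finite.biUnion D.facts.finite_toSet fun f _ => Set.finite_range f.2

instance {S : Schema} {V : Type*} (D : Database S V) : Fintype D.adom :=
  D.adom_finite.fintype

/-- The homomorphisms from the pointed database `(F, v)` to the pointed database `(D, u)`. -/
def Hom {S : Schema} {V : Type*} (F : Database S V) (v : F.adom) (D : Database S V)
    (u : D.adom) : Type _ :=
  {h : F.adom → D.adom // h v = u ∧
    ∀ (R : S.Rel) (w : Fin (S.ar R) → F.adom),
      (⟨R, fun i => (w i : V)⟩ : Fact S V) ∈ F.facts →
      (⟨R, fun i => (h (w i) : V)⟩ : Fact S V) ∈ D.facts}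

instance {S : Schema} {V : Type*} (F : Database S V) (v : F.adom) (D : Database S V)
    (u : D.adom) : Fintype (Hom F v D u) :=
  @Fintype.ofFinite _ Subtype.finite

/-! ### Feed-forward neural networks -/

/-- Feed-forward neural networks of input dimension `d` and output dimension `d'`: a finite
nonempty sequence of layers, each with a weight matrix, a bias and an activation function. -/
inductive FNN : ℕ → ℕ → Type
  | output {d d' : ℕ} (A : Matrix (Fin d) (Fin d') ℝ) (b : Fin d' → ℝ) (σ : ℝ → ℝ) : FNN d d'
  | hidden {d e d' : ℕ} (A : Matrix (Fin d) (Fin e) ℝ) (b : Fin e → ℝ) (σ : ℝ → ℝ)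
      (rest : FNN e d') : FNN d d'

/-- The function computed by an FNN; a layer maps `x` to `σ (x · A + b)`, with the activation
function applied componentwise. -/
def FNN.eval : {d d' : ℕ} → FNN d d' → (Fin d → ℝ) → (Fin d' → ℝ)
  | _, _, .output A b σ, x => fun j => σ ((∑ i, x i * A i j) + b j)
  | _, _, .hidden A b σ rest, x => rest.eval fun j => σ ((∑ i, x i * A i j) + b j)

/-- Dyadic rationals, as real numbers. -/
def IsDyadic (r : ℝ) : Prop := ∃ (z : ℤ) (s : ℕ), r = (z : ℝ) / 2 ^ s

/-- Continuous piecewise-linear functions all of whose slopes `a i`, intercepts `b i` and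
thresholds `t i` are dyadic rationals. The `i`-th piece (`0 ≤ i ≤ n`) is used at those `x`
for which exactly the first `i` thresholds are `≤ x`. -/
def IsDyadicPiecewiseLinear (σ : ℝ → ℝ) : Prop :=
  ∃ (n : ℕ) (t : Fin n → ℝ) (a b : Fin (n + 1) → ℝ),
    StrictMono t ∧
    (∀ i, IsDyadic (t i)) ∧ (∀ i, IsDyadic (a i)) ∧ (∀ i, IsDyadic (b i)) ∧
    (∀ i : Fin n, a i.castSucc * t i + b i.castSucc = a i.succ * t i + b i.succ) ∧
    ∀ (x : ℝ) (i : Fin (n + 1)),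
      (∀ j : Fin n, j.castSucc < i → t j ≤ x) →
      (∀ j : Fin n, i ≤ j.castSucc → x < t j) →
      σ x = a i * x + b i

/-- All activation functions of the FNN are dyadic rational piecewise linear. -/
def FNN.UsesDyadicActivation : {d d' : ℕ} → FNN d d' → Prop
  | _, _, .output _ _ σ => IsDyadicPiecewiseLinear σ
  | _, _, .hidden _ _ σ rest => IsDyadicPiecewiseLinear σ ∧ rest.UsesDyadicActivation

/-- All weights and biases of the FNN are dyadic rationals. -/
def FNN.UsesDyadicCoefficients : {d d' : ℕ} → FNN d d' → Prop
  | _, _, .output A b _ => (∀ i j, IsDyadic (A i j)) ∧ ∀ j, IsDyadic (b j)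
  | _, _, .hidden A b _ rest =>
      ((∀ i j, IsDyadic (A i j)) ∧ ∀ j, IsDyadic (b j)) ∧ rest.UsesDyadicCoefficients

/-- `f` is represented by an FNN with dyadic rational piecewise-linear activation and dyadic
rational coefficients. -/
def RepresentedByDyadicFNN {d d' : ℕ} (f : (Fin d → ℝ) → (Fin d' → ℝ)) : Prop :=
  ∃ N : FNN d d', N.UsesDyadicActivation ∧ N.UsesDyadicCoefficients ∧ ∀ x, N.eval x = f x

/-! ### Deep homomorphism networks -/

/-- A homomorphism query of input dimension `d` and output dimension `e`: a pointed database,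
a transformation function for each of its values, and an aggregation function. -/
structure HomQuery (S : Schema) (V : Type*) (d e : ℕ) where
  out_pos : 0 < e
  F : Database S V
  point : F.adom
  trans : F.adom → (Fin d → ℝ) → (Fin e → ℝ)
  agg : Multiset ℝ → ℝ

/-- The result of a homomorphism query on the embedded pointed database `((D, u), emb)`:
componentwise aggregation over all homomorphisms of the componentwise product. -/
def HomQuery.eval {S : Schema} {V : Type*} {d e : ℕ} (Q : HomQuery S V d e)
    (D : Database S V) (emb : D.adom → (Fin d → ℝ)) (u : D.adom) : Fin e → ℝ :=
  fun j => Q.agg ((Finset.univ : Finset (Hom Q.F Q.point D u)).val.map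
    fun h => ∏ v : Q.F.adom, Q.trans v (emb (h.1 v)) j)

/-- A DHN layer with input dimension `d` and output dimension `d'`. -/
structure Layer (S : Schema) (V : Type*) (d d' : ℕ) where
  m : ℕ
  dim : Fin m → ℕ
  query : (i : Fin m) → HomQuery S V d (dim i)
  com : ((i : Fin m) → (Fin (dim i) → ℝ)) → (Fin d' → ℝ)

/-- The embedding produced by a layer. -/
def Layer.apply {S : Schema} {V : Type*} {d d' : ℕ} (L : Layer S V d d')
    (D : Database S V) (emb : D.adom → (Fin d → ℝ)) : D.adom → (Fin d' → ℝ) :=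
  fun u => L.com fun i => (L.query i).eval D emb u

/-- Sequences of layers with matching dimensions, the first input dimension being `0` and the
last output dimension being the index. -/
inductive LayerSeq (S : Schema) (V : Type*) : ℕ → Type _
  | nil : LayerSeq S V 0
  | snoc {d d' : ℕ} (Ls : LayerSeq S V d) (L : Layer S V d d') : LayerSeq S V d'

/-- The embedding produced by a sequence of layers, starting from the empty embedding. -/
def LayerSeq.apply {S : Schema} {V : Type*} (D : Database S V) :
    {d : ℕ} → LayerSeq S V d → D.adom → (Fin d → ℝ)
  | _, .nil => fun _ => Fin.elim0
  | _, .snoc Ls L => L.apply D (Ls.apply D)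

/-- A deep homomorphism network. Acceptance only depends on where the classification function
takes the value `1`, so it is allowed to be any real-valued function; functions with values
in `{0, 1}` are a special case. -/
structure DHN (S : Schema) (V : Type*) where
  d : ℕ
  layers : LayerSeq S V d
  cls : (Fin d → ℝ) → ℝ

/-- The network accepts the pointed database `(D, u)`; otherwise it rejects it. -/
def DHN.Accepts {S : Schema} {V : Type*} (N : DHN S V) (D : Database S V) (u : D.adom) : Prop :=
  N.cls (N.layers.apply D u) = 1

/-- Every homomorphism query in the sequence of layers aggregates by summation. -/
def LayerSeq.IsSum {S : Schema} {V : Type*} : {d : ℕ} → LayerSeq S V d → Prop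
  | _, .nil => True
  | _, .snoc Ls L => Ls.IsSum ∧ ∀ i, (L.query i).agg = fun M => M.sum

/-- Sum-DHNs. -/
def DHN.IsSum {S : Schema} {V : Type*} (N : DHN S V) : Prop := N.layers.IsSum

/-- All transformation functions of the layer, and its combination function (seen as a function
of the concatenation of its argument vectors), are represented by FNNs with dyadic rational
piecewise-linear activation and dyadic rational coefficients. -/
def Layer.IsDyadic {S : Schema} {V : Type*} {d d' : ℕ} (L : Layer S V d d') : Prop :=
  (∀ i v, RepresentedByDyadicFNN ((L.query i).trans v)) ∧
  RepresentedByDyadicFNN (fun x : Fin (∑ i, L.dim i) → ℝ =>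
    L.com fun i j => x (finSigmaFinEquiv ⟨i, j⟩))

/-- All layers in the sequence satisfy `Layer.IsDyadic`. -/
def LayerSeq.IsDyadic {S : Schema} {V : Type*} : {d : ℕ} → LayerSeq S V d → Prop
  | _, .nil => True
  | _, .snoc Ls L => Ls.IsDyadic ∧ L.IsDyadic

/-- The DHN uses dyadic rational piecewise-linear activation and dyadic rational coefficients:
all its transformation, combination and classification functions are represented by FNNs
that do. -/
def DHN.IsDyadic {S : Schema} {V : Type*} (N : DHN S V) : Prop :=
  N.layers.IsDyadic ∧ RepresentedByDyadicFNN (fun x (_ : Fin 1) => N.cls x)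

/-! ### The logic HML+C -/

mutual

/-- Numerical terms with individual variables among `x₀, …, xₖ₋₁` and number variables among
`n₀, …, nₗ₋₁`. The terms of HML+C proper, `t(x, n̄)`, are those with `k = 1`; terms with more
individual variables only occur as bounding terms.

`count x p q bound atoms r arg sub` is the counting term
`#(y₁, …, y_p, m₁ < t₁, …, m_q < t_q) . ψ`, whose only free individual variable is `x`.
Inside of it, individual variable `0` is `x` and individual variable `i + 1` is the `i`-th
of the `y`s, and the number variables are the `l` old ones followed by the `m`s;
the bounding term `bound i` sees those `m`s that come before its own. The pattern
formula `ψ` is the conjunction of the relational atoms in `atoms` and of the formulas `sub s`,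
`s < r`, where `sub s` is applied to the individual variable `arg s`. -/
inductive NumTerm (S : Schema) : ℕ → ℕ → Type
  | const {k l : ℕ} (c : ℕ) : NumTerm S k l
  | var {k l : ℕ} (i : Fin l) : NumTerm S k l
  | add {k l : ℕ} (t t' : NumTerm S k l) : NumTerm S k l
  | mul {k l : ℕ} (t t' : NumTerm S k l) : NumTerm S k l
  | count {k l : ℕ} (x : Fin k) (p q : ℕ)
      (bound : (i : Fin q) → NumTerm S (p + 1) (l + (i : ℕ)))
      (atoms : List (Fact S (Fin (p + 1))))
      (r : ℕ) (arg : Fin r → Fin (p + 1)) (sub : Fin r → Formula S (l + q)) : NumTerm S k l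

/-- HML+C formulas with one individual variable and number variables among `n₀, …, nₗ₋₁`. -/
inductive Formula (S : Schema) : ℕ → Type
  | not {l : ℕ} (φ : Formula S l) : Formula S l
  | or {l : ℕ} (φ ψ : Formula S l) : Formula S l
  | le {l : ℕ} (t t' : NumTerm S 1 l) : Formula S l

end

mutual

/-- The value of a term in `D` under the assignment `a` of the individual variables and `ν` of
the number variables. -/
def NumTerm.val {S : Schema} {V : Type*} (D : Database S V) :
    {k l : ℕ} → NumTerm S k l → (Fin k → D.adom) → (Fin l → ℕ) → ℕ
  | _, _, .const c, _, _ => c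
  | _, _, .var i, _, ν => ν i
  | _, _, .add t t', a, ν => t.val D a ν + t'.val D a ν
  | _, _, .mul t t', a, ν => t.val D a ν * t'.val D a ν
  | _, _, .count x p q bound atoms r arg sub, a, ν =>
      Set.ncard {yb : (Fin p → D.adom) × (Fin q → ℕ) |
        (∀ i : Fin q, yb.2 i <
          (bound i).val D (Fin.cons (a x) yb.1 : Fin (p + 1) → D.adom)
            (Fin.append ν fun j : Fin (i : ℕ) => yb.2 (j.castLE i.isLt.le))) ∧
        (∀ f ∈ atoms,
          (⟨f.1, fun j => ((Fin.cons (a x) yb.1 : Fin (p + 1) → D.adom) (f.2 j) : V)⟩ : Fact S V)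
            ∈ D.facts) ∧
        ∀ s : Fin r, (sub s).Holds D ((Fin.cons (a x) yb.1 : Fin (p + 1) → D.adom) (arg s))
          (Fin.append ν yb.2)}

/-- Satisfaction of a formula in `D`, with its individual variable interpreted by `u` and the
number variables by `ν`. -/
def Formula.Holds {S : Schema} {V : Type*} (D : Database S V) :
    {l : ℕ} → Formula S l → D.adom → (Fin l → ℕ) → Prop
  | _, .not φ, u, ν => ¬ φ.Holds D u ν
  | _, .or φ ψ, u, ν => φ.Holds D u ν ∨ ψ.Holds D u ν
  | _, .le t t', u, ν => t.val D (fun _ => u) ν ≤ t'.val D (fun _ => u) ν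

end

end DHNLogic

end

noncomputable section

namespace DHNLogic

universe uV

variable {S : Schema} {V : Type uV}

/-! ### Definable functions and properties -/

-- Every coordinate of every embedding computed by the network has the form (P - N) / 2^s, with P
-- and N values of HML+C terms and s independent of the database; this is `RealDefinable`. Such
-- functions form a ring containing the dyadic constants, and comparing two of them reduces to P ≤
-- N. A piecewise linear activation is a combination of linear functions with threshold indicators
-- as coefficients, so `RealDefinable.fnn` needs only arithmetic and comparison.
--
-- The essential step is aggregation. A homomorphism from F is a tuple satisfying the facts of F
-- read as atoms, and a sum of natural weights f(y) over such tuples counts the pairs (y, m) with m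
-- < f(y), which is one counting term (`NatDefinable.sum_cons`). Here f is a product of values at
-- different variables, hence the bounding terms with several individual variables.
--
-- Definability is required for every number l of number variables because a counting term evaluates
-- its parts in a longer context; this replaces weakening of terms.

/-- A property of pointed databases is definable if, for every number of number variables, it is
defined by a formula of HML+C. -/
def FormulaDefinable (p : (D : Database S V) → D.adom → Prop) : Prop :=
  ∀ l, ∃ φ : Formula S l, ∀ D u ν, φ.Holds D u ν ↔ p D u

/-- A natural-number-valued function of databases with `k` chosen values is definable if, for
every number of number variables, it is the value of a term of HML+C. -/
def NatDefinable (k : ℕ) (f : (D : Database S V) → (Fin k → D.adom) → ℕ) : Prop :=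
  ∀ l, ∃ t : NumTerm S k l, ∀ D a ν, t.val D a ν = f D a

/-- A real-valued function is definable if it is a difference of definable natural-number-valued
functions divided by a constant power of two. -/
def RealDefinable (k : ℕ) (f : (D : Database S V) → (Fin k → D.adom) → ℝ) : Prop :=
  ∃ (s : ℕ) (P N : (D : Database S V) → (Fin k → D.adom) → ℕ),
    NatDefinable k P ∧ NatDefinable k N ∧ ∀ D a, f D a = ((P D a : ℝ) - N D a) / 2 ^ s

theorem NatDefinable.const {k : ℕ} (c : ℕ) :
    NatDefinable (S := S) (V := V) k fun _ _ => c :=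
  fun _ => ⟨.const c, fun _ _ _ => by simp [NumTerm.val]⟩

theorem NatDefinable.add {k : ℕ} {f g : (D : Database S V) → (Fin k → D.adom) → ℕ}
    (hf : NatDefinable k f) (hg : NatDefinable k g) :
    NatDefinable k fun D a => f D a + g D a := fun l => by
  obtain ⟨t, ht⟩ := hf l
  obtain ⟨t', ht'⟩ := hg l
  exact ⟨.add t t', fun D a ν => by simp [NumTerm.val, ht, ht']⟩

theorem NatDefinable.mul {k : ℕ} {f g : (D : Database S V) → (Fin k → D.adom) → ℕ}
    (hf : NatDefinable k f) (hg : NatDefinable k g) :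
    NatDefinable k fun D a => f D a * g D a := fun l => by
  obtain ⟨t, ht⟩ := hf l
  obtain ⟨t', ht'⟩ := hg l
  exact ⟨.mul t t', fun D a ν => by simp [NumTerm.val, ht, ht']⟩

theorem FormulaDefinable.not {p : (D : Database S V) → D.adom → Prop}
    (hp : FormulaDefinable p) : FormulaDefinable fun D u => ¬ p D u := fun l => by
  obtain ⟨φ, h⟩ := hp l
  exact ⟨.not φ, fun D u ν => by simp [Formula.Holds, h]⟩

theorem FormulaDefinable.or {p q : (D : Database S V) → D.adom → Prop}
    (hp : FormulaDefinable p) (hq : FormulaDefinable q) :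
    FormulaDefinable fun D u => p D u ∨ q D u := fun l => by
  obtain ⟨φ, h⟩ := hp l
  obtain ⟨ψ, h'⟩ := hq l
  exact ⟨.or φ ψ, fun D u ν => by simp [Formula.Holds, h, h']⟩

theorem FormulaDefinable.and {p q : (D : Database S V) → D.adom → Prop}
    (hp : FormulaDefinable p) (hq : FormulaDefinable q) :
    FormulaDefinable fun D u => p D u ∧ q D u := by
  simpa only [not_or, not_not] using (hp.not.or hq.not).not

theorem NatDefinable.le {f g : (D : Database S V) → (Fin 1 → D.adom) → ℕ}
    (hf : NatDefinable 1 f) (hg : NatDefinable 1 g) :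
    FormulaDefinable fun D u => f D (fun _ => u) ≤ g D (fun _ => u) := fun l => by
  obtain ⟨t, ht⟩ := hf l
  obtain ⟨t', ht'⟩ := hg l
  exact ⟨.le t t', fun D u ν => by simp [Formula.Holds, ht, ht']⟩

theorem FormulaDefinable.true : FormulaDefinable (S := S) (V := V) fun _ _ => True := by
  simpa using (NatDefinable.const (S := S) (V := V) 0).le (NatDefinable.const 0)

-- Weighted sums as counting terms.

/-- All relational atoms in the list hold under the assignment `a`. -/
def AtomsHold {n : ℕ} (atoms : List (Fact S (Fin n))) (D : Database S V)
    (a : Fin n → D.adom) : Prop :=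
  ∀ f ∈ atoms, (⟨f.1, fun j => (a (f.2 j) : V)⟩ : Fact S V) ∈ D.facts

/-- Each admissible y contributes one pair for each of the f(y) numbers below f(y). -/
theorem ncard_lt_eq_sum {α : Type*} [Fintype α] (p : α → Prop) [DecidablePred p] (f : α → ℕ) :
    {yb : α × (Fin 1 → ℕ) | yb.2 0 < f yb.1 ∧ p yb.1}.ncard = ∑ y, if p y then f y else 0 := by
  classical
  have e : {yb : α × (Fin 1 → ℕ) | yb.2 0 < f yb.1 ∧ p yb.1} ≃ Σ y : {y // p y}, Fin (f y) :=
    { toFun := fun z => ⟨⟨z.1.1, z.2.2⟩, ⟨z.1.2 0, z.2.1⟩⟩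
      invFun := fun z => ⟨(z.1.1, fun _ => z.2.1), z.2.2, z.1.2⟩
      left_inv := fun z => by
        ext i
        · rfl
        · simp [Subsingleton.elim i 0]
      right_inv := fun z => rfl }
  rw [← Nat.card_coe_set_eq, Nat.card_congr e, Nat.card_eq_fintype_card, Fintype.card_sigma,
    ← Finset.sum_filter]
  simp only [Fintype.card_fin]
  exact (Finset.sum_subtype (Finset.univ.filter p) (by simp) f).symm

open scoped Classical in
theorem NatDefinable.sum_cons {k p : ℕ} (x : Fin k) (atoms : List (Fact S (Fin (p + 1))))
    {q : (D : Database S V) → D.adom → Prop} (hq : FormulaDefinable q)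
    {f : (D : Database S V) → (Fin (p + 1) → D.adom) → ℕ} (hf : NatDefinable (p + 1) f) :
    NatDefinable k fun D a => ∑ y : Fin p → D.adom,
      if AtomsHold atoms D (Fin.cons (a x) y : Fin (p + 1) → D.adom) ∧ q D (a x) then
        f D (Fin.cons (a x) y : Fin (p + 1) → D.adom) else 0 := fun l => by
  -- The bounding term lives in the old context (i is 0), whereas the subformula also sees the new
  -- number variable, which it ignores.
  choose t ht using fun i : Fin 1 => hf (l + (i : ℕ))
  obtain ⟨φ, hφ⟩ := hq (l + 1)
  refine ⟨.count x p 1 t atoms 1 (fun _ => 0) fun _ => φ, fun D a ν => ?_⟩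
  beta_reduce
  rw [← ncard_lt_eq_sum]
  simp [NumTerm.val, ht, hφ, AtomsHold]

/-- Renaming an individual variable without syntactic substitution: the term #(m < t(x)). ⊤, with no
new individual variables, has the value of t at x. -/
theorem NatDefinable.comp {k : ℕ} (x : Fin k) {f : (D : Database S V) → (Fin 1 → D.adom) → ℕ}
    (hf : NatDefinable 1 f) : NatDefinable k fun D a => f D fun _ => a x := by
  have h := NatDefinable.sum_cons x [] FormulaDefinable.true hf
  have e : ∀ (D : Database S V) (u : D.adom) (y : Fin 0 → D.adom),
      (Fin.cons u y : Fin 1 → D.adom) = fun _ => u := fun D u y => by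
    ext i
    rw [Fin.fin_one_eq_zero i]
    rfl
  simpa [AtomsHold, e] using h

open scoped Classical in
theorem FormulaDefinable.indicator {q : (D : Database S V) → D.adom → Prop}
    (hq : FormulaDefinable q) : NatDefinable 1 fun D a => if q D (a 0) then 1 else 0 := by
  have h := NatDefinable.sum_cons (k := 1) (p := 0) 0 [] hq (NatDefinable.const 1)
  simpa [AtomsHold] using h

-- Arithmetic and comparison with dyadic denominators.

namespace RealDefinable

theorem congr {k : ℕ} {f g : (D : Database S V) → (Fin k → D.adom) → ℝ}
    (hf : RealDefinable k f) (h : ∀ D a, g D a = f D a) : RealDefinable k g := by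
  obtain ⟨s, P, N, hP, hN, e⟩ := hf
  exact ⟨s, P, N, hP, hN, fun D a => (h D a).trans (e D a)⟩

theorem of_nat {k : ℕ} {f : (D : Database S V) → (Fin k → D.adom) → ℕ}
    (hf : NatDefinable k f) : RealDefinable k fun D a => (f D a : ℝ) :=
  ⟨0, f, _, hf, .const 0, fun D a => by simp⟩

theorem const {k : ℕ} {r : ℝ} (hr : IsDyadic r) :
    RealDefinable (S := S) (V := V) k fun _ _ => r := by
  obtain ⟨z, s, rfl⟩ := hr
  refine ⟨s, _, _, .const z.toNat, .const (-z).toNat, fun D a => ?_⟩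
  have h : ((z.toNat : ℤ) - ((-z).toNat : ℤ)) = z := Int.toNat_sub_toNat_neg z
  have h' : (z.toNat : ℝ) - ((-z).toNat : ℝ) = z := by exact_mod_cast h
  rw [h']

theorem add {k : ℕ} {f g : (D : Database S V) → (Fin k → D.adom) → ℝ}
    (hf : RealDefinable k f) (hg : RealDefinable k g) :
    RealDefinable k fun D a => f D a + g D a := by
  obtain ⟨s, P, N, hP, hN, e⟩ := hf
  obtain ⟨s', P', N', hP', hN', e'⟩ := hg
  refine ⟨s + s', _, _, (hP.mul (.const (2 ^ s'))).add (hP'.mul (.const (2 ^ s))),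
    (hN.mul (.const (2 ^ s'))).add (hN'.mul (.const (2 ^ s))), fun D a => ?_⟩
  simp only [e, e']
  push_cast
  field_simp
  ring

theorem mul {k : ℕ} {f g : (D : Database S V) → (Fin k → D.adom) → ℝ}
    (hf : RealDefinable k f) (hg : RealDefinable k g) :
    RealDefinable k fun D a => f D a * g D a := by
  obtain ⟨s, P, N, hP, hN, e⟩ := hf
  obtain ⟨s', P', N', hP', hN', e'⟩ := hg
  refine ⟨s + s', _, _, (hP.mul hP').add (hN.mul hN'), (hP.mul hN').add (hN.mul hP'),
    fun D a => ?_⟩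
  simp only [e, e']
  push_cast
  field_simp
  ring

theorem neg {k : ℕ} {f : (D : Database S V) → (Fin k → D.adom) → ℝ}
    (hf : RealDefinable k f) : RealDefinable k fun D a => - f D a := by
  obtain ⟨s, P, N, hP, hN, e⟩ := hf
  refine ⟨s, N, P, hN, hP, fun D a => ?_⟩
  simp only [e]
  ring

theorem sub {k : ℕ} {f g : (D : Database S V) → (Fin k → D.adom) → ℝ}
    (hf : RealDefinable k f) (hg : RealDefinable k g) :
    RealDefinable k fun D a => f D a - g D a :=
  (hf.add hg.neg).congr fun _ _ => sub_eq_add_neg _ _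

theorem sum {k : ℕ} {ι : Type*} (s : Finset ι)
    {f : ι → (D : Database S V) → (Fin k → D.adom) → ℝ} (hf : ∀ i, RealDefinable k (f i)) :
    RealDefinable k fun D a => ∑ i ∈ s, f i D a := by
  classical
  induction s using Finset.induction_on with
  | empty => simpa using of_nat (NatDefinable.const (S := S) (V := V) (k := k) 0)
  | insert i s hi ih => simpa [hi] using (hf i).add ih

theorem prod {k : ℕ} {ι : Type*} (s : Finset ι)
    {f : ι → (D : Database S V) → (Fin k → D.adom) → ℝ} (hf : ∀ i, RealDefinable k (f i)) :
    RealDefinable k fun D a => ∏ i ∈ s, f i D a := by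
  classical
  induction s using Finset.induction_on with
  | empty => simpa using of_nat (NatDefinable.const (S := S) (V := V) (k := k) 1)
  | insert i s hi ih => simpa [hi] using (hf i).mul ih

theorem comp {k : ℕ} (x : Fin k) {f : (D : Database S V) → (Fin 1 → D.adom) → ℝ}
    (hf : RealDefinable 1 f) : RealDefinable k fun D a => f D fun _ => a x := by
  obtain ⟨s, P, N, hP, hN, e⟩ := hf
  exact ⟨s, _, _, hP.comp x, hN.comp x, fun D a => e D _⟩

theorem le {f g : (D : Database S V) → (Fin 1 → D.adom) → ℝ}
    (hf : RealDefinable 1 f) (hg : RealDefinable 1 g) :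
    FormulaDefinable fun D u => f D (fun _ => u) ≤ g D (fun _ => u) := by
  obtain ⟨s, P, N, hP, hN, e⟩ := hf.sub hg
  have h : ∀ (D : Database S V) (u : D.adom),
      P D (fun _ => u) ≤ N D (fun _ => u) ↔ f D (fun _ => u) ≤ g D (fun _ => u) :=
    fun D u => by
      have e' : f D (fun _ => u) - g D (fun _ => u) = _ := e D fun _ => u
      rw [← sub_nonpos (a := f D _), e', div_le_iff₀ (by positivity), zero_mul, sub_nonpos,
        Nat.cast_le]
  simpa only [h] using hP.le hN

-- The exponent s does not depend on the tuple, so the denominator leaves the sum, and P and N are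
-- summed separately.
open scoped Classical in
theorem sum_cons {p : ℕ} (atoms : List (Fact S (Fin (p + 1))))
    {f : (D : Database S V) → (Fin (p + 1) → D.adom) → ℝ} (hf : RealDefinable (p + 1) f) :
    RealDefinable 1 fun D a => ∑ y : Fin p → D.adom,
      if AtomsHold atoms D (Fin.cons (a 0) y : Fin (p + 1) → D.adom) then
        f D (Fin.cons (a 0) y : Fin (p + 1) → D.adom) else 0 := by
  obtain ⟨s, P, N, hP, hN, e⟩ := hf
  refine ⟨s, _, _, hP.sum_cons 0 atoms .true, hN.sum_cons 0 atoms .true, fun D a => ?_⟩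
  push_cast
  rw [← Finset.sum_sub_distrib, Finset.sum_div]
  refine Finset.sum_congr rfl fun y _ => ?_
  by_cases h : AtomsHold atoms D (Fin.cons (a 0) y : Fin (p + 1) → D.adom) <;> simp [h, e]

end RealDefinable

/-! ### Feed-forward networks preserve definability -/

/-- The index is that of the first threshold above x, or the last piece if there is none. -/
theorem exists_piece {n : ℕ} {t : Fin n → ℝ} (ht : StrictMono t) (x : ℝ) :
    ∃ i : Fin (n + 1), (∀ j : Fin n, j.castSucc < i → t j ≤ x) ∧
      ∀ j : Fin n, i ≤ j.castSucc → x < t j := by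
  by_cases h : ∃ j, x < t j
  · obtain ⟨j, hj, hmin⟩ := WellFounded.has_min (wellFounded_lt (α := Fin n)) {j | x < t j} h
    refine ⟨j.castSucc, fun i hi => ?_, fun i hi => lt_of_lt_of_le hj (ht.monotone ?_)⟩
    · by_contra hlt
      exact hmin i (not_le.mp hlt) (by simpa using hi)
    · simpa using hi
  · push Not at h
    exact ⟨Fin.last n, fun j _ => h j, fun j hj => absurd hj (by simp)⟩

theorem sum_ite_castSucc_lt {n : ℕ} (g : Fin (n + 1) → ℝ) (i : Fin (n + 1)) :
    (∑ j : Fin n, if j.castSucc < i then g j.succ - g j.castSucc else 0) = g i - g 0 := by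
  induction n with
  | zero => simp [Fin.fin_one_eq_zero i]
  | succ n ih =>
    cases i using Fin.cases with
    | zero => simp
    | succ i =>
      rw [Fin.sum_univ_succ]
      have h := ih (fun j => g j.succ) i
      simp only [← Fin.succ_castSucc, Fin.succ_lt_succ_iff] at *
      rw [h]
      simp

-- Start from piece 0 and add the change of linear function at each threshold already passed; the
-- sum telescopes to the active piece.
open scoped Classical in
theorem IsDyadicPiecewiseLinear.eq_sum {n : ℕ} {σ : ℝ → ℝ} {t : Fin n → ℝ}
    {a b : Fin (n + 1) → ℝ} (ht : StrictMono t)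
    (h : ∀ (x : ℝ) (i : Fin (n + 1)), (∀ j : Fin n, j.castSucc < i → t j ≤ x) →
      (∀ j : Fin n, i ≤ j.castSucc → x < t j) → σ x = a i * x + b i) (x : ℝ) :
    σ x = (a 0 * x + b 0) + ∑ j : Fin n, ((if t j ≤ x then 1 else 0 : ℕ) : ℝ) *
      ((a j.succ * x + b j.succ) - (a j.castSucc * x + b j.castSucc)) := by
  obtain ⟨i, h1, h2⟩ := exists_piece ht x
  have e : ∀ j : Fin n, t j ≤ x ↔ j.castSucc < i := fun j =>
    ⟨fun hj => not_le.mp fun hi => (h2 j hi).not_ge hj, h1 j⟩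
  have := sum_ite_castSucc_lt (fun i => a i * x + b i) i
  simp only [e, Nat.cast_ite, Nat.cast_one, Nat.cast_zero, ite_mul, one_mul, zero_mul, this]
  rw [h x i h1 h2]
  ring

theorem RealDefinable.activation {σ : ℝ → ℝ} (hσ : IsDyadicPiecewiseLinear σ)
    {f : (D : Database S V) → (Fin 1 → D.adom) → ℝ} (hf : RealDefinable 1 f) :
    RealDefinable 1 fun D a => σ (f D a) := by
  classical
  obtain ⟨n, t, a, b, ht, dt, da, db, -, h⟩ := hσ
  have lin : ∀ i, RealDefinable 1 fun D x => a i * f D x + b i := fun i =>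
    ((RealDefinable.const (da i)).mul hf).add (.const (db i))
  refine ((lin 0).add (.sum Finset.univ fun j => (RealDefinable.of_nat
    (((RealDefinable.const (dt j)).le hf).indicator)).mul
      ((lin j.succ).sub (lin j.castSucc)))).congr fun D x => ?_
  have e : (fun _ => x 0) = x := funext fun i => by rw [Subsingleton.elim i 0]
  rw [IsDyadicPiecewiseLinear.eq_sum ht h]
  simp only [e]

theorem RealDefinable.fnn {d d' : ℕ} (N : FNN d d') (hσ : N.UsesDyadicActivation)
    (hc : N.UsesDyadicCoefficients) {f : Fin d → (D : Database S V) → (Fin 1 → D.adom) → ℝ}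
    (hf : ∀ i, RealDefinable 1 (f i)) (j : Fin d') :
    RealDefinable 1 fun D a => N.eval (fun i => f i D a) j := by
  induction N with
  | output A b σ =>
    simp only [FNN.eval]
    exact .activation hσ <|
      (RealDefinable.sum _ fun i => (hf i).mul (.const (hc.1 i j))).add (.const (hc.2 j))
  | hidden A b σ rest ih =>
    simp only [FNN.eval]
    exact ih hσ.2 hc.2 (fun j => .activation hσ.1 <|
      (RealDefinable.sum _ fun i => (hf i).mul (.const (hc.1.1 i j))).add (.const (hc.1.2 j))) j

theorem RealDefinable.represented {d d' : ℕ} {F : (Fin d → ℝ) → (Fin d' → ℝ)}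
    (hF : RepresentedByDyadicFNN F) {f : Fin d → (D : Database S V) → (Fin 1 → D.adom) → ℝ}
    (hf : ∀ i, RealDefinable 1 (f i)) (j : Fin d') :
    RealDefinable 1 fun D a => F (fun i => f i D a) j := by
  obtain ⟨N, hσ, hc, e⟩ := hF
  simpa only [e] using RealDefinable.fnn N hσ hc hf j

/-! ### Homomorphism queries preserve definability -/

/-- The distinguished value gets index 0 because a counting term keeps its free variable there. -/
theorem Database.exists_enum (F : Database S V) (v : F.adom) :
    ∃ (p : ℕ) (e : F.adom ≃ Fin (p + 1)), e v = 0 := by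
  classical
  have hpos : 0 < Fintype.card F.adom := Fintype.card_pos_iff.mpr ⟨v⟩
  obtain ⟨p, hp⟩ := Nat.exists_eq_succ_of_ne_zero hpos.ne'
  let e := Fintype.equivFinOfCardEq hp
  exact ⟨p, e.trans (Equiv.swap (e v) 0), by simp⟩

/-- The facts of `F` as relational atoms whose variables are given by an enumeration of the
active domain. -/
def Database.toAtoms (F : Database S V) {n : ℕ} (e : F.adom ≃ Fin n) :
    List (Fact S (Fin n)) :=
  F.facts.attach.toList.map fun f => ⟨f.1.1, fun i => e ⟨f.1.2 i, f.1, f.2, i, rfl⟩⟩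

theorem Database.atomsHold_toAtoms (F : Database S V) {n : ℕ} (e : F.adom ≃ Fin n)
    (D : Database S V) (a : Fin n → D.adom) :
    AtomsHold (F.toAtoms e) D a ↔ ∀ (R : S.Rel) (w : Fin (S.ar R) → F.adom),
      (⟨R, fun i => (w i : V)⟩ : Fact S V) ∈ F.facts →
      (⟨R, fun i => (a (e (w i)) : V)⟩ : Fact S V) ∈ D.facts := by
  constructor
  · intro h R w hw
    exact h _ (List.mem_map.mpr ⟨⟨_, hw⟩, by simp, rfl⟩)
  · intro h f hf
    obtain ⟨⟨⟨R, w⟩, hw⟩, -, rfl⟩ := List.mem_map.mp hf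
    exact h R (fun i => ⟨w i, _, hw, i, rfl⟩) hw

-- A homomorphism is determined by its values off the distinguished point, where it must be u; the
-- remaining condition is exactly the atoms of F.
open scoped Classical in
theorem sum_hom_eq (F : Database S V) (v : F.adom) {p : ℕ} (e : F.adom ≃ Fin (p + 1))
    (he : e v = 0) (D : Database S V) (u : D.adom) (G : (Fin (p + 1) → D.adom) → ℝ) :
    ∑ h : Hom F v D u, G (fun i => h.1 (e.symm i)) = ∑ y : Fin p → D.adom,
      if AtomsHold (F.toAtoms e) D (Fin.cons u y : Fin (p + 1) → D.adom) then
        G (Fin.cons u y : Fin (p + 1) → D.adom) else 0 := by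
  have he' : e.symm 0 = v := by rw [← he, e.symm_apply_apply]
  have key : ∀ h : Hom F v D u, (Fin.cons u (fun i : Fin p => h.1 (e.symm i.succ)) :
      Fin (p + 1) → D.adom) = fun i => h.1 (e.symm i) := fun h => by
    funext i
    cases i using Fin.cases with
    | zero => simp [he', h.2.1]
    | succ i => simp
  rw [← Finset.sum_filter]
  refine Finset.sum_bij' (fun h _ i => h.1 (e.symm i.succ))
    (fun y hy => ⟨fun w => (Fin.cons u y : Fin (p + 1) → D.adom) (e w), by simp [he],
      (F.atomsHold_toAtoms e D _).mp (Finset.mem_filter.mp hy).2⟩) ?_ ?_ ?_ ?_ ?_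
  · intro h _
    rw [Finset.mem_filter, key, F.atomsHold_toAtoms]
    simpa using h.2.2
  · exact fun _ _ => Finset.mem_univ _
  · intro h _
    refine Subtype.ext (funext fun w => ?_)
    simp [key]
  · intro y _
    funext i
    simp
  · intro h _
    rw [key]

theorem RealDefinable.homQuery {d n : ℕ} (Q : HomQuery S V d n)
    (hsum : Q.agg = fun M => M.sum) (hQ : ∀ v, RepresentedByDyadicFNN (Q.trans v))
    {emb : (D : Database S V) → D.adom → (Fin d → ℝ)}
    (hemb : ∀ i, RealDefinable 1 fun D a => emb D (a 0) i) (j : Fin n) :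
    RealDefinable 1 fun D a => Q.eval D (emb D) (a 0) j := by
  classical
  obtain ⟨p, e, he⟩ := Q.F.exists_enum Q.point
  -- Each factor depends on one variable only; `comp` moves it to its own variable, and the product
  -- becomes the weight to be summed.
  have hprod : RealDefinable (p + 1) fun D a =>
      ∏ v : Q.F.adom, Q.trans v (emb D (a (e v))) j :=
    .prod _ fun v => (RealDefinable.represented (hQ v) hemb j).comp (e v)
  refine (hprod.sum_cons (Q.F.toAtoms e)).congr fun D a => ?_
  rw [← sum_hom_eq Q.F Q.point e he D (a 0)
    fun b => ∏ v : Q.F.adom, Q.trans v (emb D (b (e v))) j]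
  simp only [HomQuery.eval, hsum, Equiv.symm_apply_apply]
  rfl

-- Layers, layer sequences and acceptance.

theorem RealDefinable.layer {d d' : ℕ} (L : Layer S V d d')
    (hsum : ∀ i, (L.query i).agg = fun M => M.sum) (hL : L.IsDyadic)
    {emb : (D : Database S V) → D.adom → (Fin d → ℝ)}
    (hemb : ∀ i, RealDefinable 1 fun D a => emb D (a 0) i) (j : Fin d') :
    RealDefinable 1 fun D a => L.apply D (emb D) (a 0) j := by
  have hq : ∀ m : Fin (∑ i, L.dim i), RealDefinable 1 fun D a =>
      (L.query (finSigmaFinEquiv.symm m).1).eval D (emb D) (a 0) (finSigmaFinEquiv.symm m).2 :=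
    fun m => .homQuery _ (hsum _) (hL.1 _) hemb _
  refine (RealDefinable.represented hL.2 hq j).congr fun D a => ?_
  -- The type of the second component depends on the first, so decoding an encoded index is handled
  -- by substituting for a general s.
  have e : ∀ (i : Fin L.m) (k : Fin (L.dim i)) (s : Σ i, Fin (L.dim i)), s = ⟨i, k⟩ →
      (L.query s.1).eval D (emb D) (a 0) s.2 = (L.query i).eval D (emb D) (a 0) k := by
    rintro i k s rfl
    rfl
  simp only [Layer.apply]
  congr 2
  funext i k
  exact (e i k _ (Equiv.symm_apply_apply _ _)).symm

theorem RealDefinable.layerSeq {d : ℕ} (Ls : LayerSeq S V d) (hsum : Ls.IsSum)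
    (hLs : Ls.IsDyadic) (j : Fin d) : RealDefinable 1 fun D a => Ls.apply D (a 0) j := by
  induction Ls with
  | nil => exact j.elim0
  | snoc Ls L ih => exact .layer L hsum.2 hLs.2 (ih hsum.1 hLs.1) j

theorem isDyadic_one : IsDyadic 1 := ⟨1, 0, by simp⟩

theorem DHN.formulaDefinable_accepts (N : DHN S V) (hsum : N.IsSum) (hdyadic : N.IsDyadic) :
    FormulaDefinable fun D u => N.Accepts D u := by
  have h := RealDefinable.represented hdyadic.2 (RealDefinable.layerSeq N.layers hsum hdyadic.1) 0
  have h1 := RealDefinable.const (S := S) (V := V) (k := 1) isDyadic_one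
  -- The test `cls = 1` is the conjunction of two definable inequalities.
  simpa only [DHN.Accepts, le_antisymm_iff] using (h.le h1).and (h1.le h)

end DHNLogic

end

theorem theorem6 (S : DHNLogic.Schema) (V : Type*) [Countable V] [Infinite V]
    (N : DHNLogic.DHN S V) (hsum : N.IsSum) (hdyadic : N.IsDyadic) :
    ∃ φ : DHNLogic.Formula S 0, ∀ (D : DHNLogic.Database S V) (u : D.adom),
      N.Accepts D u ↔ φ.Holds D u Fin.elim0 := by
  obtain ⟨φ, h⟩ := N.formulaDefinable_accepts hsum hdyadic 0
  exact ⟨φ, fun D u => (h D u Fin.elim0).symm⟩
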